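/- There are absolute constants $c>0$ and $c'>0$ such that the following holds for every integer $n\ge 0$ and every $p$ with $0<p\le 1/2$. Let $V_n(p)$ be the weighted cube, i.e. $\{0,1\}^n$ with the product probability measure under which the coordinates are independent and each equals $1$ with probability $p$ and $0$ with probability $1-p$. Let $f:V_n(p)\to\{0,1\}$ be any function, and put $t=\Pr(f^{-1}(1))$. For $1\le k\le n$ let $I_f(k)$, the influence of the $k$th coordinate, be the probability of the set of all $\omega$ for which there is an $\omega'$ differing from $\omega$ only in the $k$th coordinate with $f(\omega')\ne f(\omega)$, and let $I_f=\sum_{k=1}^n I_f(k)$. Let $\log$ denote the natural logarithm. (i) If $\delta$ is a real number such that $I_f(k)\le\delta$ for every $k$, then \[ I_f \ \ge\ c\,\frac{t(1-t)}{p\log(1/p)}\,\log\left(\frac{c\,t(1-t)}{\delta^{1/2}I_f}\right). \] (ii) If $a\le 1/2$ is a real number such that $I_f(k)\le a\,p^2\log(1/p)^2$ for every $k$, then \[ I_f \ \ge\ c'\,\frac{t(1-t)}{p\log(1/p)}\,\log(1/a). \] (If $f$ is constant, so that $t(1-t)=0$ and $I_f=0$, the right-hand sides are read as $0$. If $f$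 is not constant, the hypotheses force $\delta>0$, $I_f>0$ and $a>0$.) -/

import Mathlib

open MeasureTheory ProbabilityTheory

/-- The influence `I_f(k)` of the `k`-th coordinate with respect to a function `f` on the product
probability space `Ω ^ n` (each factor carrying the probability measure `μ`): the probability of
the set of configurations `ω` for which there is a configuration `ω'` differing from `ω` only in
the `k`-th coordinate with `f ω' ≠ f ω`. -/
noncomputable def influence {Ω α : Type*} [MeasurableSpace Ω] (μ : Measure Ω) {n : ℕ}
    (f : (Fin n → Ω) → α) (k : Fin n) : ℝ :=
  (Measure.pi fun _ : Fin n => μ).real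
    {ω | ∃ ω' : Fin n → Ω, (∀ j, j ≠ k → ω' j = ω j) ∧ f ω' ≠ f ω}

/-- The total influence `I_f`, the sum of the influences of all coordinates. -/
noncomputable def totalInfluence {Ω α : Type*} [MeasurableSpace Ω] (μ : Measure Ω) {n : ℕ}
    (f : (Fin n → Ω) → α) : ℝ :=
  ∑ k : Fin n, influence μ f k

/-- The two-point probability space `V_1(p)`: the measure on `{0, 1}` which gives mass `p` to `1`
and mass `1 - p` to `0`. -/
noncomputable def twoPoint (p : unitInterval) : Measure (Fin 2) :=
  bernoulliMeasure 1 0 p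

/-- The weighted cube `V_n(p)`: the product measure on `{0, 1} ^ n` whose factors are all
`V_1(p)`. -/
noncomputable def weightedCube (n : ℕ) (p : unitInterval) : Measure (Fin n → Fin 2) :=
  Measure.pi fun _ : Fin n => twoPoint p

/-!
The argument is the entropy method of Falik and Samorodnitsky, carried out on the `p`-biased cube.
For a single biased bit, `Ent(g²) ≤ 16 p log(1/p) (g 1 - g 0)²` (`twoPoint_logSobolev`), and the
logarithmic Sobolev inequality tensorizes (`cubeEntropy_sq_le`). In the other direction, the entropy
of `h²` is large when the `L¹` norm of `h` is small compared to its `L²` norm; in linearized form,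
`Ent(h²) ≥ (1 + log s) ‖h‖₂² - s ‖h‖₁²` for every `s > 0` (`le_cubeEntropy_sq`).

Both bounds are applied to every difference in the martingale obtained from `g` by revealing the
coordinates one at a time. The squared `L²` norms of the differences add up to the variance of `g`,
their energies add up to the energy of `g`, and the `L¹` norm of the difference belonging to
coordinate `k` is at most the `L¹` norm of `g - E_k g`, where `E_k` averages over coordinate `k`.
The outcome is `variance_le_energy_add`. For a function with values in `{0, 1}` it reads, when all
influences are at most `δ`,
`(1 + log s) t (1 - t) ≤ 16 p log(1/p) I_f + s p δ I_f` (`variance_le_influence_add`).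

The choice `s = δ^(-1/2)` gives `t (1 - t) log(1/δ) ≤ 36 p log(1/p) I_f`, which contains the second
bound because `p log(1/p) ≤ 1`. The choice `s = 1` gives `t (1 - t) ≤ 17 I_f`, whence
`t (1 - t) / (36 δ^(1/2) I_f) ≤ δ^(-1/2)`, and the first bound follows as well.
-/

open Function

/-! ### The biased mean, entropy and discrete derivatives -/

/-- The expectation of `g` on the `p`-biased cube, as a finite sum. The weights make sense for every
real `p`; they are probabilities when `0 ≤ p ≤ 1`. -/
noncomputable def biasedMean (p : ℝ) {n : ℕ} (g : (Fin n → Fin 2) → ℝ) : ℝ :=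
  ∑ x, (∏ i, if x i = 1 then p else 1 - p) * g x

/-- The entropy `E[φ log φ] - E[φ] log E[φ]` of a nonnegative function `φ` on the `p`-biased cube.
The value `Real.log 0 = 0` produces the usual convention `0 log 0 = 0`. -/
noncomputable def cubeEntropy (p : ℝ) {n : ℕ} (φ : (Fin n → Fin 2) → ℝ) : ℝ :=
  biasedMean p (fun x => φ x * Real.log (φ x)) - biasedMean p φ * Real.log (biasedMean p φ)

/-- The discrete derivative of `g` in the direction of coordinate `k`, a function which does not
depend on that coordinate. -/
def coordDiff {n : ℕ} (k : Fin n) (g : (Fin n → Fin 2) → ℝ) (x : Fin n → Fin 2) : ℝ :=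
  g (update x k 1) - g (update x k 0)

namespace biasedMean

variable {p : ℝ} {n : ℕ}

theorem zero_dim (g : (Fin 0 → Fin 2) → ℝ) : biasedMean p g = g default := by
  rw [biasedMean, Fintype.sum_unique, Fin.prod_univ_zero, one_mul]
  exact congrArg g (Subsingleton.elim _ _)

/-- Conditioning on the first coordinate. -/
theorem succ (g : (Fin (n + 1) → Fin 2) → ℝ) :
    biasedMean p g = (1 - p) * biasedMean p (fun y => g (Fin.cons 0 y)) +
      p * biasedMean p (fun y => g (Fin.cons 1 y)) := by
  unfold biasedMean
  rw [← (Fin.consEquiv fun _ : Fin (n + 1) => Fin 2).sum_comp, Fintype.sum_prod_type,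
    Fin.sum_univ_two, Finset.mul_sum, Finset.mul_sum]
  simp [Fin.consEquiv, Fin.prod_univ_succ, mul_assoc]

theorem add (g h : (Fin n → Fin 2) → ℝ) :
    biasedMean p (fun x => g x + h x) = biasedMean p g + biasedMean p h := by
  simp [biasedMean, mul_add, Finset.sum_add_distrib]

theorem const_mul (c : ℝ) (g : (Fin n → Fin 2) → ℝ) :
    biasedMean p (fun x => c * g x) = c * biasedMean p g := by
  simp only [biasedMean, Finset.mul_sum]
  exact Finset.sum_congr rfl fun _ _ => by ring

theorem sub (g h : (Fin n → Fin 2) → ℝ) :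
    biasedMean p (fun x => g x - h x) = biasedMean p g - biasedMean p h := by
  simp [biasedMean, mul_sub, Finset.sum_sub_distrib]

theorem weight_nonneg (hp0 : 0 < p) (hp : p ≤ 1 / 2) (x : Fin n → Fin 2) :
    0 ≤ ∏ i, if x i = 1 then p else 1 - p :=
  Finset.prod_nonneg fun i _ => by split_ifs <;> linarith

theorem mono (hp0 : 0 < p) (hp : p ≤ 1 / 2) {g h : (Fin n → Fin 2) → ℝ} (hgh : ∀ x, g x ≤ h x) :
    biasedMean p g ≤ biasedMean p h :=
  Finset.sum_le_sum fun x _ => mul_le_mul_of_nonneg_left (hgh x) (weight_nonneg hp0 hp x)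

theorem nonneg (hp0 : 0 < p) (hp : p ≤ 1 / 2) {g : (Fin n → Fin 2) → ℝ} (hg : ∀ x, 0 ≤ g x) :
    0 ≤ biasedMean p g :=
  Finset.sum_nonneg fun x _ => mul_nonneg (weight_nonneg hp0 hp x) (hg x)

theorem mul_eq_zero_of_eq_zero (hp0 : 0 < p) (hp : p ≤ 1 / 2) {g : (Fin n → Fin 2) → ℝ}
    (hg : ∀ x, 0 ≤ g x) (h0 : biasedMean p g = 0) (u : (Fin n → Fin 2) → ℝ) :
    biasedMean p (fun x => g x * u x) = 0 := by
  have h := (Finset.sum_eq_zero_iff_of_nonneg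
    fun x _ => mul_nonneg (weight_nonneg hp0 hp x) (hg x)).1 h0
  exact Finset.sum_eq_zero fun x hx => by rw [← mul_assoc, h x hx, zero_mul]

theorem sq_mul_le (hp0 : 0 < p) (hp : p ≤ 1 / 2) (g h : (Fin n → Fin 2) → ℝ) :
    biasedMean p (fun x => g x * h x) ^ 2 ≤
      biasedMean p (fun x => g x ^ 2) * biasedMean p (fun x => h x ^ 2) :=
  Finset.sum_sq_le_sum_mul_sum_of_sq_le_mul _
    (fun x _ => mul_nonneg (weight_nonneg hp0 hp x) (sq_nonneg _))
    (fun x _ => mul_nonneg (weight_nonneg hp0 hp x) (sq_nonneg _)) fun x _ => le_of_eq (by ring)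

/-- The reverse triangle inequality for the `L²` norm. -/
theorem sq_sqrt_sub_sqrt_le (hp0 : 0 < p) (hp : p ≤ 1 / 2) (g h : (Fin n → Fin 2) → ℝ) :
    (√(biasedMean p fun x => g x ^ 2) - √(biasedMean p fun x => h x ^ 2)) ^ 2 ≤
      biasedMean p fun x => (g x - h x) ^ 2 := by
  have hg := nonneg hp0 hp fun x => sq_nonneg (g x)
  have hh := nonneg hp0 hp fun x => sq_nonneg (h x)
  have hcs : biasedMean p (fun x => g x * h x) ≤
      √(biasedMean p fun x => g x ^ 2) * √(biasedMean p fun x => h x ^ 2) := by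
    rw [← Real.sqrt_mul hg]
    exact Real.le_sqrt_of_sq_le (sq_mul_le hp0 hp g h)
  have he : (biasedMean p fun x => (g x - h x) ^ 2) = biasedMean p (fun x => g x ^ 2) -
      2 * biasedMean p (fun x => g x * h x) + biasedMean p (fun x => h x ^ 2) := by
    rw [← const_mul, ← sub, ← add]
    congr 1; ext x; ring
  rw [he, sub_sq, Real.sq_sqrt hg, Real.sq_sqrt hh]
  linarith

end biasedMean

section coordDiff

variable {n : ℕ}

theorem coordDiff_zero_cons (g : (Fin (n + 1) → Fin 2) → ℝ) (b : Fin 2) (y : Fin n → Fin 2) :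
    coordDiff 0 g (Fin.cons b y) = g (Fin.cons 1 y) - g (Fin.cons 0 y) := by
  simp [coordDiff, Fin.update_cons_zero]

theorem coordDiff_succ_cons (k : Fin n) (g : (Fin (n + 1) → Fin 2) → ℝ) (b : Fin 2)
    (y : Fin n → Fin 2) :
    coordDiff k.succ g (Fin.cons b y) = coordDiff k (fun z => g (Fin.cons b z)) y := by
  simp [coordDiff, Fin.cons_update]

end coordDiff

/-! ### The logarithmic Sobolev inequality on the biased cube -/

theorem nine_sixteenths_le_log_one_div {p : ℝ} (hp0 : 0 < p) (hp : p ≤ 1 / 2) :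
    (9 / 16 : ℝ) ≤ Real.log (1 / p) := by
  have h : Real.log 2 ≤ Real.log (1 / p) :=
    Real.log_le_log two_pos (by rw [le_div_iff₀ hp0]; linarith)
  linarith [Real.log_two_gt_d9]

theorem mul_log_sub_log_le {x m : ℝ} (hx : 0 ≤ x) (hm : 0 < m) :
    x * Real.log x - x * Real.log m ≤ x * (x / m - 1) := by
  rcases hx.eq_or_lt with rfl | hx
  · simp
  · rw [← mul_sub, ← Real.log_div hx.ne' hm.ne']
    exact mul_le_mul_of_nonneg_left (Real.log_le_sub_one_of_pos (div_pos hx hm)) hx.le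

/-- The logarithmic Sobolev inequality for one `p`-biased bit. If `a ≤ 2 b`, the entropy is at most
the variance of the square divided by its mean, and `b ^ 2` is comparable to the mean. If `2 b < a`,
then only the term with `a` contributes positively, `a ^ 2` is at most the mean divided by `p`, and
`a` is comparable to `a - b`. -/
theorem twoPoint_logSobolev {p a b : ℝ} (hp0 : 0 < p) (hp : p ≤ 1 / 2) (ha : 0 ≤ a) (hb : 0 ≤ b) :
    (1 - p) * (b ^ 2 * Real.log (b ^ 2)) + p * (a ^ 2 * Real.log (a ^ 2)) -
      ((1 - p) * b ^ 2 + p * a ^ 2) * Real.log ((1 - p) * b ^ 2 + p * a ^ 2) ≤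
    16 * p * Real.log (1 / p) * (a - b) ^ 2 := by
  have hl := nine_sixteenths_le_log_one_div hp0 hp
  set l := Real.log (1 / p)
  have hq : 0 < 1 - p := by linarith
  obtain ⟨m, hm⟩ : ∃ m, m = (1 - p) * b ^ 2 + p * a ^ 2 := ⟨_, rfl⟩
  rw [← hm]
  rcases le_or_gt a (2 * b) with hab | hab
  · rcases hb.eq_or_lt with rfl | hb
    · obtain rfl : a = 0 := by linarith
      simp [hm]
    have hm0 : 0 < m := by rw [hm]; positivity
    have h1 := mul_le_mul_of_nonneg_left (mul_log_sub_log_le (sq_nonneg a) hm0) hp0.le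
    have h2 := mul_le_mul_of_nonneg_left (mul_log_sub_log_le (sq_nonneg b) hm0) hq.le
    have h3 : p * (a ^ 2 * (a ^ 2 / m - 1)) + (1 - p) * (b ^ 2 * (b ^ 2 / m - 1)) =
        p * (a - b) ^ 2 * ((1 - p) * (a + b) ^ 2 / m) := by
      field_simp
      rw [hm]; ring
    have h4 : (1 - p) * (a + b) ^ 2 / m ≤ 9 := by
      rw [div_le_iff₀ hm0]
      have : (a + b) ^ 2 ≤ (3 * b) ^ 2 := pow_le_pow_left₀ (by linarith) (by linarith) 2
      nlinarith [mul_le_mul_of_nonneg_left this hq.le, mul_nonneg hp0.le (sq_nonneg a)]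
    have h5 : p * (a - b) ^ 2 * ((1 - p) * (a + b) ^ 2 / m) ≤ p * (a - b) ^ 2 * (16 * l) :=
      mul_le_mul_of_nonneg_left (by linarith) (by positivity)
    have h6 : m * Real.log m = p * (a ^ 2 * Real.log m) + (1 - p) * (b ^ 2 * Real.log m) := by
      rw [← mul_assoc, ← mul_assoc, ← add_mul, add_comm, ← hm]
    nlinarith
  · have ha0 : 0 < a := by linarith
    have hm0 : 0 < m := by rw [hm]; positivity
    have h1 : Real.log (a ^ 2) ≤ Real.log m + l := by
      rw [← Real.log_mul hm0.ne' (by positivity)]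
      refine Real.log_le_log (by positivity) ?_
      rw [mul_one_div, le_div_iff₀ hp0]
      nlinarith [mul_nonneg hq.le (sq_nonneg b)]
    have h2 : b ^ 2 * Real.log (b ^ 2) ≤ b ^ 2 * Real.log m := by
      rcases hb.eq_or_lt with rfl | hb
      · simp
      refine mul_le_mul_of_nonneg_left (Real.log_le_log (by positivity) ?_) (sq_nonneg b)
      nlinarith [mul_le_mul_of_nonneg_left (pow_le_pow_left₀ hb.le (by linarith : b ≤ a) 2) hp0.le]
    have h3 := mul_le_mul_of_nonneg_left h1 (mul_nonneg hp0.le (sq_nonneg a))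
    have h4 := mul_le_mul_of_nonneg_left h2 hq.le
    have h5 : a ^ 2 ≤ (2 * (a - b)) ^ 2 := pow_le_pow_left₀ ha0.le (by linarith) 2
    have hpl : 0 ≤ p * l := mul_nonneg hp0.le (by linarith)
    have h6 := mul_le_mul_of_nonneg_left h5 hpl
    have h7 : m * Real.log m = p * (a ^ 2 * Real.log m) + (1 - p) * (b ^ 2 * Real.log m) := by
      rw [← mul_assoc, ← mul_assoc, ← add_mul, add_comm, ← hm]
    nlinarith [mul_nonneg hpl (sq_nonneg (a - b))]

/-- The logarithmic Sobolev inequality on the `p`-biased cube. The entropy on `n + 1` coordinates is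
the mean of the entropies on the two faces plus the entropy of a two-point function whose values are
the squared `L²` norms of `g` on the faces. -/
theorem cubeEntropy_sq_le {p : ℝ} (hp0 : 0 < p) (hp : p ≤ 1 / 2) {n : ℕ}
    (g : (Fin n → Fin 2) → ℝ) :
    cubeEntropy p (fun x => g x ^ 2) ≤
      16 * p * Real.log (1 / p) * ∑ k, biasedMean p fun x => coordDiff k g x ^ 2 := by
  induction n with
  | zero => simp [cubeEntropy, biasedMean.zero_dim]
  | succ n ih =>
    have hl := nine_sixteenths_le_log_one_div hp0 hp
    have h0 := mul_le_mul_of_nonneg_left (ih fun y => g (Fin.cons 0 y))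
      (by linarith : 0 ≤ 1 - p)
    have h1 := mul_le_mul_of_nonneg_left (ih fun y => g (Fin.cons 1 y)) hp0.le
    have h2 := twoPoint_logSobolev hp0 hp
      (Real.sqrt_nonneg (biasedMean p fun y => g (Fin.cons 1 y) ^ 2))
      (Real.sqrt_nonneg (biasedMean p fun y => g (Fin.cons 0 y) ^ 2))
    rw [Real.sq_sqrt (biasedMean.nonneg hp0 hp fun y => sq_nonneg _),
      Real.sq_sqrt (biasedMean.nonneg hp0 hp fun y => sq_nonneg _)] at h2
    have h3 := mul_le_mul_of_nonneg_left (biasedMean.sq_sqrt_sub_sqrt_le hp0 hp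
      (fun y => g (Fin.cons 1 y)) fun y => g (Fin.cons 0 y))
      (by positivity : 0 ≤ 16 * p * Real.log (1 / p))
    rw [Fin.sum_univ_succ]
    simp only [cubeEntropy, biasedMean.succ, coordDiff_zero_cons, coordDiff_succ_cons,
      Finset.sum_add_distrib, ← Finset.mul_sum] at h0 h1 ⊢
    linarith

/-- A lower bound on the entropy of `g ^ 2` by the `L²` and `L¹` norms of `g`. Optimizing over `s`
turns the left side into `‖g‖₂² log (‖g‖₂² / ‖g‖₁²)`; the linearized form needs no case distinction
when these norms vanish and can be summed over several functions with the same `s`. -/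
theorem le_cubeEntropy_sq {p : ℝ} (hp0 : 0 < p) (hp : p ≤ 1 / 2) {n : ℕ}
    (g : (Fin n → Fin 2) → ℝ) {s : ℝ} (hs : 0 < s) :
    (1 + Real.log s) * biasedMean p (fun x => g x ^ 2) - s * biasedMean p (fun x => |g x|) ^ 2 ≤
      cubeEntropy p fun x => g x ^ 2 := by
  have hN := biasedMean.nonneg hp0 hp fun x => sq_nonneg (g x)
  unfold cubeEntropy
  rcases hN.eq_or_lt with hN | hN
  · rw [biasedMean.mul_eq_zero_of_eq_zero hp0 hp (fun x => sq_nonneg (g x)) hN.symm, ← hN]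
    simp only [mul_zero, zero_mul, sub_zero, zero_sub, neg_nonpos]
    positivity
  set N := biasedMean p fun x => g x ^ 2 with hNdef
  -- This is `log y ≤ y - 1` at `y = √(s N) / |g x|`, multiplied by `2 (g x)²`.
  have key : ∀ x, (Real.log s + 2 + Real.log N) * g x ^ 2 - 2 * (√s * √N) * |g x| ≤
      g x ^ 2 * Real.log (g x ^ 2) := by
    intro x
    rcases eq_or_ne (g x) 0 with h | h
    · simp [h]
    have ha : 0 < |g x| := abs_pos.2 h
    have h1 := Real.log_le_sub_one_of_pos (show 0 < √s * √N / |g x| by positivity)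
    rw [Real.log_div (by positivity) ha.ne', Real.log_mul (by positivity) (by positivity),
      Real.log_sqrt hs.le, Real.log_sqrt hN.le] at h1
    have h2 := mul_le_mul_of_nonneg_left h1 (sq_nonneg |g x|)
    have h3 : |g x| ^ 2 * (√s * √N / |g x| - 1) = (√s * √N) * |g x| - |g x| ^ 2 := by
      field_simp
    rw [h3, sq_abs] at h2
    rw [Real.log_pow, ← Real.log_abs (g x)]
    push_cast
    linarith
  have h := biasedMean.mono hp0 hp key
  rw [biasedMean.sub, biasedMean.const_mul, biasedMean.const_mul, ← hNdef] at h
  have h4 : 0 ≤ (√s * biasedMean p (fun x => |g x|) - √N) ^ 2 := sq_nonneg _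
  rw [sub_sq, mul_pow, Real.sq_sqrt hs.le, Real.sq_sqrt hN.le] at h4
  linarith

/-! ### The martingale decomposition -/

/-- The inequality of Falik and Samorodnitsky in linearized form. In the induction, `g` is the sum
of its average `a` over the first coordinate, to which the induction hypothesis applies, and the
remainder `h`, to which the entropy bounds apply; variance and energy are additive for this sum.
The quantity `2 p (1 - p) E|coordDiff k g|` is the `L¹` norm of `g` minus its average over
coordinate `k`. -/
theorem variance_le_energy_add {p : ℝ} (hp0 : 0 < p) (hp : p ≤ 1 / 2) {s : ℝ} (hs : 0 < s) {n : ℕ}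
    (g : (Fin n → Fin 2) → ℝ) :
    (1 + Real.log s) * (biasedMean p (fun x => g x ^ 2) - biasedMean p g ^ 2) ≤
      16 * p * Real.log (1 / p) * ∑ k, biasedMean p (fun x => coordDiff k g x ^ 2) +
      s * ∑ k, (2 * p * (1 - p) * biasedMean p fun x => |coordDiff k g x|) ^ 2 := by
  induction n with
  | zero => simp [biasedMean.zero_dim]
  | succ n ih =>
    have hq : 0 < 1 - p := by linarith
    set g₀ : (Fin n → Fin 2) → ℝ := fun y => g (Fin.cons 0 y) with hg₀
    set g₁ : (Fin n → Fin 2) → ℝ := fun y => g (Fin.cons 1 y) with hg₁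
    set a : (Fin n → Fin 2) → ℝ := fun y => (1 - p) * g₀ y + p * g₁ y with ha
    set h : (Fin (n + 1) → Fin 2) → ℝ := fun x => g x - a (Fin.tail x) with hh
    have hh0 : ∀ y, h (Fin.cons 0 y) = -(p * (g₁ y - g₀ y)) := fun y => by
      simp only [hh, ha, Fin.tail_cons, hg₀]; ring
    have hh1 : ∀ y, h (Fin.cons 1 y) = (1 - p) * (g₁ y - g₀ y) := fun y => by
      simp only [hh, ha, Fin.tail_cons, hg₁]; ring
    -- `h` has mean zero in the first coordinate, hence is orthogonal to functions of the others.
    have hvar : biasedMean p (fun x => g x ^ 2) - biasedMean p g ^ 2 =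
        (biasedMean p (fun y => a y ^ 2) - biasedMean p a ^ 2) +
          biasedMean p (fun x => h x ^ 2) := by
      have hm : biasedMean p g = biasedMean p a := by
        rw [biasedMean.succ, ha, biasedMean.add, biasedMean.const_mul, biasedMean.const_mul]
      have hsq : biasedMean p (fun x => g x ^ 2) =
          biasedMean p (fun y => a y ^ 2) + biasedMean p (fun x => h x ^ 2) := by
        simp only [biasedMean.succ, hh0, hh1]
        simp only [← biasedMean.const_mul, ← biasedMean.add]
        congr 1; ext y; simp only [ha, hg₀, hg₁]; ring
      rw [hm, hsq]; ring
    have hent := (le_cubeEntropy_sq hp0 hp h hs).trans (cubeEntropy_sq_le hp0 hp h)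
    have hD0 : ∀ x, coordDiff 0 h x = coordDiff 0 g x := fun x => by
      simp only [coordDiff, hh, Fin.tail_update_zero]; ring
    have hL1 : biasedMean p (fun x => |h x|) =
        2 * p * (1 - p) * biasedMean p (fun x => |coordDiff 0 g x|) := by
      simp only [biasedMean.succ, hh0, hh1, abs_neg, abs_mul, abs_of_pos hp0, abs_of_pos hq,
        coordDiff_zero_cons, biasedMean.const_mul, hg₀, hg₁]
      ring
    have hDsq : ∀ k : Fin n, biasedMean p (fun x => coordDiff k.succ g x ^ 2) =
        biasedMean p (fun y => coordDiff k a y ^ 2) +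
          biasedMean p (fun x => coordDiff k.succ h x ^ 2) := fun k => by
      simp only [biasedMean.succ, coordDiff_succ_cons, hh0, hh1]
      simp only [← biasedMean.const_mul, ← biasedMean.add]
      congr 1; ext y; simp only [coordDiff, ha, hg₀, hg₁]; ring
    have hDabs : ∀ k : Fin n, biasedMean p (fun y => |coordDiff k a y|) ≤
        biasedMean p (fun x => |coordDiff k.succ g x|) := fun k => by
      simp only [biasedMean.succ, coordDiff_succ_cons]
      simp only [← biasedMean.const_mul, ← biasedMean.add]
      refine biasedMean.mono hp0 hp fun y => ?_
      have e : coordDiff k a y = (1 - p) * coordDiff k g₀ y + p * coordDiff k g₁ y := by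
        simp only [coordDiff, ha]; ring
      rw [e]
      refine (abs_add_le _ _).trans_eq ?_
      rw [abs_mul, abs_mul, abs_of_pos hp0, abs_of_pos hq]
    have hsum : ∑ k, (2 * p * (1 - p) * biasedMean p fun y => |coordDiff k a y|) ^ 2 ≤
        ∑ k : Fin n, (2 * p * (1 - p) * biasedMean p fun x => |coordDiff k.succ g x|) ^ 2 :=
      Finset.sum_le_sum fun k _ => pow_le_pow_left₀
        (mul_nonneg (by positivity) (biasedMean.nonneg hp0 hp fun _ => abs_nonneg _))
        (mul_le_mul_of_nonneg_left (hDabs k) (by positivity)) 2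
    have iha := ih a
    have hsum' := mul_le_mul_of_nonneg_left hsum hs.le
    rw [hL1, Fin.sum_univ_succ] at hent
    rw [hvar, Fin.sum_univ_succ, Fin.sum_univ_succ]
    simp only [hDsq, Finset.sum_add_distrib, hD0] at hent ⊢
    linarith

/-! ### Influences of functions with values in `{0, 1}` -/

section Influence

variable {n : ℕ} {p : unitInterval}

theorem weightedCube_real_singleton (x : Fin n → Fin 2) :
    (weightedCube n p).real {x} = ∏ i, if x i = 1 then (p : ℝ) else 1 - p := by
  have : IsProbabilityMeasure (twoPoint p) := by unfold twoPoint; infer_instance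
  rw [weightedCube, Measure.real, ← Set.univ_pi_singleton, Measure.pi_pi, ENNReal.toReal_prod]
  refine Finset.prod_congr rfl fun i _ => ?_
  change (bernoulliMeasure 1 0 p).real _ = _
  rw [bernoulliMeasure_real_apply p (MeasurableSet.singleton _)]
  match x i with
  | 0 => simp
  | 1 => simp

open Classical in
theorem weightedCube_real_eq_biasedMean (s : Set (Fin n → Fin 2)) :
    (weightedCube n p).real s = biasedMean p fun x => if x ∈ s then 1 else 0 := by
  have : IsProbabilityMeasure (twoPoint p) := by unfold twoPoint; infer_instance
  have : IsProbabilityMeasure (weightedCube n p) := by unfold weightedCube; infer_instance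
  rw [← Set.coe_toFinset s, ← sum_measureReal_singleton]
  simp only [biasedMean, weightedCube_real_singleton, mul_ite, mul_one, mul_zero,
    ← Finset.sum_filter]
  exact Finset.sum_congr (by ext; simp) fun _ _ => rfl

/-- Coordinate `k` is pivotal at `x` exactly when the two settings of it give different values. -/
theorem exists_flip_iff (f : (Fin n → Fin 2) → Fin 2) (k : Fin n) (x : Fin n → Fin 2) :
    (∃ x' : Fin n → Fin 2, (∀ j, j ≠ k → x' j = x j) ∧ f x' ≠ f x) ↔
      f (update x k 1) ≠ f (update x k 0) := by
  constructor
  · rintro ⟨x', hx', hne⟩ heq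
    have hc : ∀ b, f (update x k b) = f (update x k 0) := fun b => by
      match b with
      | 0 => rfl
      | 1 => exact heq
    have h1 : x' = update x k (x' k) := by
      ext j; by_cases hj : j = k
      · subst hj; simp
      · simp [hj, hx' j hj]
    have h2 : f x = f (update x k 0) := by rw [← hc (x k), update_eq_self]
    exact hne (by rw [h1, hc, h2])
  · intro h
    by_cases h0 : f (update x k 0) = f x
    · exact ⟨update x k 1, fun j hj => by simp [hj], h0 ▸ h⟩
    · exact ⟨update x k 0, fun j hj => by simp [hj], h0⟩

theorem influence_eq_biasedMean_abs (f : (Fin n → Fin 2) → Fin 2) (k : Fin n) :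
    influence (twoPoint p) f k =
      biasedMean p fun x => |coordDiff k (fun y => ((f y : ℕ) : ℝ)) x| := by
  refine (weightedCube_real_eq_biasedMean _).trans ?_
  congr 1; ext x
  simp only [Set.mem_ofPred_eq, exists_flip_iff, coordDiff]
  generalize f (update x k 1) = u
  generalize f (update x k 0) = v
  match u, v with
  | 0, 0 => simp
  | 0, 1 => simp
  | 1, 0 => simp
  | 1, 1 => simp

theorem influence_eq_biasedMean_sq (f : (Fin n → Fin 2) → Fin 2) (k : Fin n) :
    influence (twoPoint p) f k =
      biasedMean p fun x => coordDiff k (fun y => ((f y : ℕ) : ℝ)) x ^ 2 := by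
  rw [influence_eq_biasedMean_abs]
  congr 1; ext x
  simp only [coordDiff]
  generalize f (update x k 1) = u
  generalize f (update x k 0) = v
  match u, v with
  | 0, 0 => simp
  | 0, 1 => simp
  | 1, 0 => simp
  | 1, 1 => simp

theorem influence_nonneg (f : (Fin n → Fin 2) → Fin 2) (k : Fin n) :
    0 ≤ influence (twoPoint p) f k := measureReal_nonneg

theorem totalInfluence_nonneg (f : (Fin n → Fin 2) → Fin 2) :
    0 ≤ totalInfluence (twoPoint p) f :=
  Finset.sum_nonneg fun k _ => influence_nonneg f k

theorem influence_le_one (f : (Fin n → Fin 2) → Fin 2) (k : Fin n) :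
    influence (twoPoint p) f k ≤ 1 := by
  have : IsProbabilityMeasure (twoPoint p) := by unfold twoPoint; infer_instance
  exact measureReal_le_one

theorem variance_le_influence_add (hp0 : 0 < (p : ℝ)) (hp : (p : ℝ) ≤ 1 / 2)
    (f : (Fin n → Fin 2) → Fin 2) {δ s : ℝ} (hs : 0 < s)
    (hδ : ∀ k, influence (twoPoint p) f k ≤ δ) :
    (1 + Real.log s) * ((weightedCube n p).real (f ⁻¹' {1}) *
        (1 - (weightedCube n p).real (f ⁻¹' {1}))) ≤
      16 * p * Real.log (1 / p) * totalInfluence (twoPoint p) f +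
        s * (p * δ * totalInfluence (twoPoint p) f) := by
  have ht : (weightedCube n p).real (f ⁻¹' {1}) = biasedMean p fun x => ((f x : ℕ) : ℝ) := by
    rw [weightedCube_real_eq_biasedMean]
    congr 1; ext x
    simp only [Set.mem_preimage, Set.mem_singleton_iff]
    match f x with
    | 0 => simp
    | 1 => simp
  have ht2 : (biasedMean p fun x => ((f x : ℕ) : ℝ) ^ 2) =
      biasedMean p fun x => ((f x : ℕ) : ℝ) := by
    congr 1; ext x
    match f x with
    | 0 => simp
    | 1 => simp
  have h := variance_le_energy_add hp0 hp hs fun x => ((f x : ℕ) : ℝ)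
  simp only [← influence_eq_biasedMean_sq, ← influence_eq_biasedMean_abs, ht2, ← ht] at h
  change _ ≤ 16 * p * Real.log (1 / p) * totalInfluence (twoPoint p) f + _ at h
  have hpq : 4 * (p : ℝ) * (1 - p) ^ 2 ≤ 1 := by nlinarith [sq_nonneg (2 * (p : ℝ) - 1)]
  have h2 : ∑ k, (2 * (p : ℝ) * (1 - p) * influence (twoPoint p) f k) ^ 2 ≤
      p * δ * totalInfluence (twoPoint p) f := by
    rw [totalInfluence, Finset.mul_sum]
    refine Finset.sum_le_sum fun k _ => ?_
    have hk := influence_nonneg (p := p) f k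
    calc (2 * (p : ℝ) * (1 - p) * influence (twoPoint p) f k) ^ 2
        = 4 * (p : ℝ) * (1 - p) ^ 2 *
          (p * (influence (twoPoint p) f k * influence (twoPoint p) f k)) := by ring
      _ ≤ 1 * (p * (δ * influence (twoPoint p) f k)) :=
          mul_le_mul hpq (mul_le_mul_of_nonneg_left (mul_le_mul_of_nonneg_right (hδ k) hk) hp0.le)
            (by positivity) zero_le_one
      _ = p * δ * influence (twoPoint p) f k := by ring
  have h3 := mul_le_mul_of_nonneg_left h2 hs.le
  linarith

theorem mul_log_one_div_le_one (hp0 : 0 < (p : ℝ)) : (p : ℝ) * Real.log (1 / p) ≤ 1 := by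
  have h := mul_le_mul_of_nonneg_left (Real.log_le_sub_one_of_pos (one_div_pos.2 hp0)) hp0.le
  rw [mul_sub, mul_one_div_cancel hp0.ne'] at h
  linarith

theorem variance_nonneg (f : (Fin n → Fin 2) → Fin 2) :
    0 ≤ (weightedCube n p).real (f ⁻¹' {1}) * (1 - (weightedCube n p).real (f ⁻¹' {1})) := by
  have : IsProbabilityMeasure (twoPoint p) := by unfold twoPoint; infer_instance
  have : IsProbabilityMeasure (weightedCube n p) := by unfold weightedCube; infer_instance
  exact mul_nonneg measureReal_nonneg (sub_nonneg.2 measureReal_le_one)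

/-- A crude Poincaré inequality: the sharp constant is `p (1 - p)`. -/
theorem variance_le_totalInfluence (hp0 : 0 < (p : ℝ)) (hp : (p : ℝ) ≤ 1 / 2)
    (f : (Fin n → Fin 2) → Fin 2) :
    (weightedCube n p).real (f ⁻¹' {1}) * (1 - (weightedCube n p).real (f ⁻¹' {1})) ≤
      17 * totalInfluence (twoPoint p) f := by
  have h := variance_le_influence_add hp0 hp f one_pos (influence_le_one f)
  have hI := totalInfluence_nonneg (p := p) f
  have h1 := mul_le_mul_of_nonneg_right (mul_log_one_div_le_one hp0) hI
  have h2 := mul_le_mul_of_nonneg_right hp hI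
  simp only [Real.log_one, add_zero, one_mul, mul_one] at h
  linarith

/-- The influence bound of Talagrand type which implies both parts of the theorem. -/
theorem variance_mul_log_le (hp0 : 0 < (p : ℝ)) (hp : (p : ℝ) ≤ 1 / 2)
    (f : (Fin n → Fin 2) → Fin 2) {δ : ℝ} (hδ0 : 0 < δ) (hδ1 : δ ≤ 1)
    (hδ : ∀ k, influence (twoPoint p) f k ≤ δ) :
    (weightedCube n p).real (f ⁻¹' {1}) * (1 - (weightedCube n p).real (f ⁻¹' {1})) *
        Real.log (1 / δ) ≤
      36 * (p * Real.log (1 / p) * totalInfluence (twoPoint p) f) := by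
  have hI := totalInfluence_nonneg (p := p) f
  have hV := variance_nonneg (p := p) f
  have hd : 0 < √δ := Real.sqrt_pos.2 hδ0
  have h := variance_le_influence_add hp0 hp f (inv_pos.2 hd) hδ
  have e1 : (√δ)⁻¹ * (p * δ * totalInfluence (twoPoint p) f) =
      √δ * (p * totalInfluence (twoPoint p) f) := by
    nth_rw 2 [← Real.mul_self_sqrt hδ0.le]
    field_simp
  have h1 : √δ * (p * totalInfluence (twoPoint p) f) ≤ p * totalInfluence (twoPoint p) f :=
    mul_le_of_le_one_left (by positivity) (Real.sqrt_le_one.2 hδ1)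
  have h2 := mul_le_mul_of_nonneg_left (nine_sixteenths_le_log_one_div hp0 hp)
    (by positivity : 0 ≤ p * totalInfluence (twoPoint p) f)
  rw [e1, Real.log_inv, Real.log_sqrt hδ0.le] at h
  rw [one_div δ, Real.log_inv]
  nlinarith

end Influence

/-! ### Lower bounds on the total influence -/

theorem lemma2 :
    (∃ c : ℝ, 0 < c ∧
      ∀ (n : ℕ) (p : unitInterval), 0 < (p : ℝ) → (p : ℝ) ≤ 1 / 2 →
      ∀ (f : (Fin n → Fin 2) → Fin 2) (t : ℝ), (weightedCube n p).real (f ⁻¹' {1}) = t →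
      ∀ δ : ℝ, (∀ k : Fin n, influence (twoPoint p) f k ≤ δ) →
        c * (t * (1 - t) / ((p : ℝ) * Real.log (1 / (p : ℝ)))) *
            Real.log (c * t * (1 - t) / (Real.sqrt δ * totalInfluence (twoPoint p) f))
          ≤ totalInfluence (twoPoint p) f) ∧
    (∃ c' : ℝ, 0 < c' ∧
      ∀ (n : ℕ) (p : unitInterval), 0 < (p : ℝ) → (p : ℝ) ≤ 1 / 2 →
      ∀ (f : (Fin n → Fin 2) → Fin 2) (t : ℝ), (weightedCube n p).real (f ⁻¹' {1}) = t →
      ∀ a : ℝ, a ≤ 1 / 2 →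
        (∀ k : Fin n,
          influence (twoPoint p) f k ≤ a * (p : ℝ) ^ 2 * Real.log (1 / (p : ℝ)) ^ 2) →
        c' * (t * (1 - t) / ((p : ℝ) * Real.log (1 / (p : ℝ)))) * Real.log (1 / a)
          ≤ totalInfluence (twoPoint p) f) := by
  constructor
  · refine ⟨1 / 36, by norm_num, fun n p hp0 hp f t ht δ hδ => ?_⟩
    have hI := totalInfluence_nonneg (p := p) f
    have hV := variance_nonneg (p := p) f
    have hVI := variance_le_totalInfluence hp0 hp f
    have hT := fun h0 h1 => variance_mul_log_le hp0 hp f (δ := δ) h0 h1 hδ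
    have hl := nine_sixteenths_le_log_one_div hp0 hp
    rw [ht] at hV hVI hT
    have hpl : 0 < (p : ℝ) * Real.log (1 / p) := mul_pos hp0 (by linarith)
    rw [mul_assoc (1 / 36 : ℝ) t]
    set V := t * (1 - t)
    set I := totalInfluence (twoPoint p) f
    rcases hV.eq_or_lt with hV0 | hV0
    · simpa [← hV0] using hI
    have hI0 : 0 < I := by linarith
    have hδ0 : 0 < δ := by
      by_contra! hneg
      exact hI0.not_ge (Finset.sum_nonpos fun k _ => (hδ k).trans hneg)
    have hd : 0 < √δ := Real.sqrt_pos.2 hδ0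
    -- Here `V ≤ 17 I` makes the argument of the logarithm at most `δ^(-1/2)`.
    have hlog : Real.log (1 / 36 * V / (√δ * I)) ≤ Real.log (1 / δ) / 2 := by
      rw [one_div δ, Real.log_inv, neg_div, ← Real.log_sqrt hδ0.le, ← Real.log_inv]
      refine Real.log_le_log (by positivity) ?_
      rw [div_le_iff₀ (by positivity), inv_mul_cancel_left₀ hd.ne']
      linarith
    refine (mul_le_mul_of_nonneg_left hlog (by positivity)).trans ?_
    rcases le_total δ 1 with h1 | h1
    · have := hT hδ0 h1
      rw [show 1 / 36 * (V / (p * Real.log (1 / p))) * (Real.log (1 / δ) / 2) =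
        (V * Real.log (1 / δ)) / (72 * (p * Real.log (1 / p))) by field_simp; ring,
        div_le_iff₀ (by positivity)]
      nlinarith
    · have : Real.log (1 / δ) ≤ 0 := by
        rw [one_div, Real.log_inv]; linarith [Real.log_nonneg h1]
      exact (mul_nonpos_of_nonneg_of_nonpos (by positivity) (by linarith)).trans hI
  · refine ⟨1 / 36, by norm_num, fun n p hp0 hp f t ht a ha hfa => ?_⟩
    have hI := totalInfluence_nonneg (p := p) f
    have hV := variance_nonneg (p := p) f
    have hVI := variance_le_totalInfluence hp0 hp f
    have hl := nine_sixteenths_le_log_one_div hp0 hp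
    have hpl : 0 < (p : ℝ) * Real.log (1 / p) := mul_pos hp0 (by linarith)
    have hpl1 := mul_log_one_div_le_one hp0
    have hpl2 : (p : ℝ) ^ 2 * Real.log (1 / p) ^ 2 ≤ 1 := by
      rw [← mul_pow]; exact pow_le_one₀ hpl.le hpl1
    have hT := fun h0 h => variance_mul_log_le hp0 hp f (δ := a) h0 (by linarith) h
    rw [ht] at hV hVI hT
    -- For `a ≤ 0` all influences vanish, so `f` is constant and both sides are `0`.
    rcases le_or_gt a 0 with ha0 | ha0
    · have hI0 : totalInfluence (twoPoint p) f ≤ 0 := Finset.sum_nonpos fun k _ =>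
        (hfa k).trans (by
          rw [mul_assoc]; exact mul_nonpos_of_nonpos_of_nonneg ha0 (by positivity))
      have hV0 : t * (1 - t) = 0 := by linarith
      simpa [hV0] using hI
    · have h := hT ha0 fun k => (hfa k).trans (by
        rw [mul_assoc]; exact mul_le_of_le_one_right ha0.le hpl2)
      rw [show 1 / 36 * (t * (1 - t) / (p * Real.log (1 / p))) * Real.log (1 / a) =
        (t * (1 - t) * Real.log (1 / a)) / (36 * (p * Real.log (1 / p))) by field_simp,
        div_le_iff₀ (by positivity)]
      linarith
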